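/- **Theorem 3.5 (Monotonicity of the quantum relative entropy, Uhlmann inequality).** Let $H$ and $H'$ be finite-dimensional complex Hilbert spaces, and let $L(H)$ denote the linear operators on $H$. A state (density operator) on $H$ is an operator $\rho \in L(H)$ with $\rho \ge 0$ and $\operatorname{tr}[\rho] = 1$. For states $\rho, \sigma$ on the same Hilbert space, the quantum relative entropy is $$S(\rho\|\sigma) := \operatorname{tr}[\rho \ln \rho] - \operatorname{tr}[\rho \ln \sigma] \in (-\infty, +\infty]$$ (with the convention $0 \ln 0 = 0$, and with $\ln\sigma$ taken on the support of $\sigma$), where $S(\rho\|\sigma) := +\infty$ if there is a vector $\psi$ with $\sigma\psi = 0$ and $\langle \psi, \rho\psi\rangle \neq 0$. A linear map $\mathcal E : L(H) \to L(H')$ is CPTP if it is completely positive, i.e. for every $n \in \mathbb N$ and every positive $n \times n$ matrix $(X_{kl})$ with entries in $L(H)$ the matrix $(\mathcal E(X_{kl}))$ is positive (equivalently, $\mathcal E \otimes \mathcal I_n$ is positive, $\mathcal I_n$ being the identity map on $L(\mathbb C^n)$), and trace-preserving, i.e. $\operatorname{tr}[\mathcal E(X)] = \operatorname{tr}[X]$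 for all $X \in L(H)$. Then for all states $\rho, \sigma$ on $H$ and every CPTP map $\mathcal E : L(H) \to L(H')$, $$S(\mathcal E(\rho)\|\mathcal E(\sigma)) \le S(\rho\|\sigma).$$ -/

import Mathlib

open scoped CStarAlgebra InnerProductSpace

namespace QuantumEntropy

noncomputable section

/-- The trace of an operator on a (finite-dimensional) Hilbert space. -/
def opTrace {H : Type*} [NormedAddCommGroup H] [InnerProductSpace ℂ H] (X : H →L[ℂ] H) : ℂ :=
  LinearMap.trace ℂ H X.toLinearMap

/-- The set `Q(H)` of density operators (states): positive operators of trace one. Here `0 ≤ ρ` is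
the Loewner order, that is, `ρ` is self-adjoint with `0 ≤ ⟨ψ, ρ ψ⟩` for every `ψ`. -/
def densityOperators (H : Type*) [NormedAddCommGroup H] [InnerProductSpace ℂ H] :
    Set (H →L[ℂ] H) :=
  {ρ | 0 ≤ ρ ∧ opTrace ρ = 1}

/-- A map between operator algebras is trace-preserving if `tr (E X) = tr X` for every operator
`X`. -/
def TracePreserving {H H' : Type*} [NormedAddCommGroup H] [InnerProductSpace ℂ H]
    [NormedAddCommGroup H'] [InnerProductSpace ℂ H']
    (E : (H →L[ℂ] H) → (H' →L[ℂ] H')) : Prop :=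
  ∀ X, opTrace (E X) = opTrace X

open scoped Classical in
/-- The quantum relative entropy `S(ρ‖σ) = tr (ρ ln ρ) - tr (ρ ln σ)`, with value `+∞` if there is a
vector `ψ` with `σ ψ = 0` and `⟨ψ, ρ ψ⟩ ≠ 0`. The operator logarithm is taken through the functional
calculus with `Real.log 0 = 0`: this gives the convention `0 ln 0 = 0` in `ρ ln ρ`, and when the
value is finite `ρ` vanishes on the kernel of `σ`, so that the convention plays no role in
`ρ ln σ`. For states both traces are real, so `re` loses nothing. -/
def relativeEntropy {H : Type*} [NormedAddCommGroup H] [InnerProductSpace ℂ H] [CompleteSpace H]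
    (ρ σ : H →L[ℂ] H) : EReal :=
  if ∃ ψ : H, σ ψ = 0 ∧ ⟪ψ, ρ ψ⟫_ℂ ≠ 0 then ⊤
  else (((opTrace (ρ * CFC.log ρ) - opTrace (ρ * CFC.log σ)).re : ℝ) : EReal)

end

end QuantumEntropy

/-!
The relative entropy is monotone because it is an integral, over `t > 0`, of quantities that are
maxima of a quadratic functional which a completely positive trace-preserving map can only lower.

For `t > 0` put `Q_t(Y) = 2 Re tr (Y σ) - tr (ρ Y Y*) - t tr (σ Y* Y)` (`modularForm`). In eigenbases
of `ρ` and `σ`, with eigenvalues `p i`, `q j` and overlaps `w i j = |⟨b i, f j⟩|²`, completing squares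
gives `max Q_t = ∑ w i j (q j)² / (p i + t q j)` (`isGreatest_modularForm`). Since
`x log x = ∫₀^∞ (x / (1 + t) - 1 + t / (x + t)) dt`, substituting `x = p i / q j` and summing with
weights `w i j q j` yields
`S(ρ‖σ) = ∫₀^∞ (tr ρ / (1 + t) - tr σ + t max Q_t) dt`.
Instead of the improper integral, the proof uses the explicit primitive of the integrand, which
vanishes at `0` and tends to `S(ρ‖σ)` at infinity (`exists_interpolation`).

Let `E` be completely positive and trace preserving, and let `Z` be the value at `Y` of the dual of
`E` for the trace pairing. Complete positivity of `E`, applied to the positive `2 × 2` operator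
matrix with entries `ρ, ρ Z*, Z ρ, Z ρ Z*`, gives the Kadison–Schwarz inequality
`tr (ρ Z* Z) ≤ tr (E(ρ) Y* Y)` (`re_opTrace_schwarz`). Using it for `σ` and `Y`, and for `ρ` and `Y*`,
the functional of `(E(ρ), E(σ))` at `Y` is at most that of `(ρ, σ)` at `Z`
(`exists_modularForm_le`). Hence the difference of the two primitives is monotone in `t`, and its
limit at infinity is nonnegative. The same inequality, applied to the rank-one operator of a vector
in the kernel of `E(σ)`, shows that a finite `S(ρ‖σ)` forces the support condition for the images
(`inner_map_eq_zero`), so that `S(E(ρ)‖E(σ))` is then given by the trace formula as well.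
-/

namespace QuantumEntropy

open Filter Topology

/-! ### The trace of operators -/

section Trace

variable {H : Type*} [NormedAddCommGroup H] [InnerProductSpace ℂ H]

lemma opTrace_add (X Y : H →L[ℂ] H) : opTrace (X + Y) = opTrace X + opTrace Y := by
  simp [opTrace]

lemma opTrace_sub (X Y : H →L[ℂ] H) : opTrace (X - Y) = opTrace X - opTrace Y := by
  simp [opTrace]

lemma opTrace_smul (c : ℂ) (X : H →L[ℂ] H) : opTrace (c • X) = c * opTrace X := by
  simp [opTrace]

lemma opTrace_mul_comm (X Y : H →L[ℂ] H) : opTrace (X * Y) = opTrace (Y * X) :=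
  LinearMap.trace_mul_comm ℂ X.toLinearMap Y.toLinearMap

/-- The bilinear trace pairing `(Z, X) ↦ tr (Z X)` on operators. -/
noncomputable def opTraceForm : (H →L[ℂ] H) →ₗ[ℂ] Module.Dual ℂ (H →L[ℂ] H) :=
  LinearMap.mk₂ ℂ (fun Z X => opTrace (Z * X))
    (by intros; rw [add_mul, opTrace_add]) (by intros; rw [smul_mul_assoc, opTrace_smul]; rfl)
    (by intros; rw [mul_add, opTrace_add]) (by intros; rw [mul_smul_comm, opTrace_smul]; rfl)

lemma opTrace_eq_sum_inner {ι : Type*} [Fintype ι] (b : OrthonormalBasis ι ℂ H)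
    (X : H →L[ℂ] H) : opTrace X = ∑ i, ⟪b i, X (b i)⟫_ℂ :=
  LinearMap.trace_eq_sum_inner X.toLinearMap b

lemma opTrace_mul_eq_sum {ι : Type*} [Fintype ι] {ρ : H →L[ℂ] H} {b : OrthonormalBasis ι ℂ H}
    {p : ι → ℝ} (hb : ∀ i, ρ (b i) = (p i : ℂ) • b i) (X : H →L[ℂ] H) :
    opTrace (X * ρ) = ∑ i, p i * ⟪b i, X (b i)⟫_ℂ := by
  simp [opTrace_eq_sum_inner b, hb]

variable [FiniteDimensional ℂ H]

lemma re_opTrace_nonneg {X : H →L[ℂ] H} (hX : 0 ≤ X) : 0 ≤ (opTrace X).re := by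
  rw [opTrace_eq_sum_inner (stdOrthonormalBasis ℂ H), Complex.re_sum]
  rw [ContinuousLinearMap.nonneg_iff_isPositive] at hX
  exact Finset.sum_nonneg fun i _ => hX.re_inner_nonneg_right _

variable [CompleteSpace H]

lemma opTrace_star (X : H →L[ℂ] H) : opTrace (star X) = star (opTrace X) := by
  simp [opTrace_eq_sum_inner (stdOrthonormalBasis ℂ H), ContinuousLinearMap.star_eq_adjoint,
    ContinuousLinearMap.adjoint_inner_right]

/-- The trace pairing on operators is perfect: every linear functional is `X ↦ tr (Z X)`. -/
lemma exists_opTrace_mul_eq (f : (H →L[ℂ] H) →ₗ[ℂ] ℂ) :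
    ∃ Z : H →L[ℂ] H, ∀ X, opTrace (Z * X) = f X := by
  have hB : Function.Injective (opTraceForm (H := H)) := by
    rw [← LinearMap.ker_eq_bot, LinearMap.ker_eq_bot']
    intro Z hZ
    have h : opTrace (star Z * Z) = 0 := by
      rw [opTrace_mul_comm]; exact LinearMap.congr_fun hZ (star Z)
    let b := stdOrthonormalBasis ℂ H
    have h2 : ∑ i, ‖Z (b i)‖ ^ 2 = 0 := by
      have := congrArg Complex.re h
      rw [opTrace_eq_sum_inner b, Complex.re_sum] at this
      rw [← Complex.zero_re, ← this]
      refine Finset.sum_congr rfl fun i _ => ?_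
      rw [mul_apply_eq_comp, ContinuousLinearMap.star_eq_adjoint,
        ContinuousLinearMap.adjoint_inner_right]
      exact (inner_self_eq_norm_sq (𝕜 := ℂ) _).symm
    rw [Finset.sum_eq_zero_iff_of_nonneg fun _ _ => by positivity] at h2
    apply ContinuousLinearMap.coe_injective
    refine b.toBasis.ext fun i => ?_
    simpa using h2 i (Finset.mem_univ i)
  obtain ⟨Z, hZ⟩ := (LinearMap.injective_iff_surjective_of_finrank_eq_finrank
    Subspace.dual_finrank_eq.symm).1 hB f
  exact ⟨Z, fun X => LinearMap.congr_fun hZ X⟩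

end Trace

/-! ### Eigenbases and the functional calculus -/

section Spectral

variable {H : Type*} [NormedAddCommGroup H] [InnerProductSpace ℂ H]

lemma apply_eq_zero_of_inner_eq_zero [CompleteSpace H] {T : H →L[ℂ] H} (hT : 0 ≤ T) {x : H}
    (hx : ⟪x, T x⟫_ℂ = 0) : T x = 0 := by
  obtain ⟨S, rfl⟩ := CStarAlgebra.nonneg_iff_eq_star_mul_self.1 hT
  rw [mul_apply_eq_comp, ContinuousLinearMap.star_eq_adjoint,
    ContinuousLinearMap.adjoint_inner_right, inner_self_eq_zero] at hx
  rw [mul_apply_eq_comp, hx, map_zero]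

lemma inner_apply_eq_sum [CompleteSpace H] {ι : Type*} [Fintype ι] {ρ : H →L[ℂ] H}
    {b : OrthonormalBasis ι ℂ H} {p : ι → ℝ} (hρ : IsSelfAdjoint ρ)
    (hb : ∀ i, ρ (b i) = (p i : ℂ) • b i) (x : H) :
    ⟪x, ρ x⟫_ℂ = ((∑ i, p i * ‖⟪b i, x⟫_ℂ‖ ^ 2 : ℝ) : ℂ) := by
  rw [← b.sum_inner_mul_inner]
  push_cast
  refine Finset.sum_congr rfl fun i _ => ?_
  have h : ⟪b i, ρ x⟫_ℂ = p i * ⟪b i, x⟫_ℂ := by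
    rw [← ContinuousLinearMap.adjoint_inner_left, ← ContinuousLinearMap.star_eq_adjoint,
      hρ.star_eq, hb, inner_smul_left, Complex.conj_ofReal]
  rw [h, mul_left_comm, ← inner_conj_symm x, Complex.conj_mul']

variable [FiniteDimensional ℂ H]

lemma exists_eigenbasis_of_nonneg {ρ : H →L[ℂ] H} (hρ : 0 ≤ ρ) :
    ∃ (b : OrthonormalBasis (Fin (Module.finrank ℂ H)) ℂ H) (p : Fin (Module.finrank ℂ H) → ℝ),
      (∀ i, 0 ≤ p i) ∧ ∀ i, ρ (b i) = (p i : ℂ) • b i := by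
  rw [ContinuousLinearMap.nonneg_iff_isPositive] at hρ
  have h := (ContinuousLinearMap.isPositive_toLinearMap_iff ρ).2 hρ
  exact ⟨h.isSymmetric.eigenvectorBasis rfl, h.isSymmetric.eigenvalues rfl,
    h.nonneg_eigenvalues rfl, h.isSymmetric.apply_eigenvectorBasis rfl⟩

variable [CompleteSpace H]

/-- The functional calculus acts on an eigenvector by the value of the function at the
eigenvalue. -/
lemma cfc_apply_of_apply_eq_smul (f : ℝ → ℝ) {a : H →L[ℂ] H} (ha : IsSelfAdjoint a) {x : H}
    {r : ℝ} (hx : a x = (r : ℂ) • x) : cfc f a x = (f r : ℂ) • x := by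
  classical
  have hfin : (spectrum ℝ a).Finite := by
    rw [← spectrum.preimage_algebraMap (R := ℝ) ℂ]
    refine Set.Finite.preimage (FaithfulSMul.algebraMap_injective ℝ ℂ).injOn ?_
    refine (Module.End.finite_spectrum a.toLinearMap).subset ?_
    exact AlgHom.spectrum_apply_subset
      (Module.End.toContinuousLinearMap (𝕜 := ℂ) H).toAlgHom a.toLinearMap
  -- On the finite spectrum, `f` agrees with an interpolation polynomial.
  let s := insert r hfin.toFinset
  let P := Lagrange.interpolate s id f
  have hP : ∀ y ∈ s, P.eval y = f y := fun y hy =>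
    Lagrange.eval_interpolate_at_node f Function.injective_id.injOn hy
  have h1 : cfc f a = Polynomial.aeval a P := by
    rw [← cfc_polynomial P a ha]
    exact cfc_congr fun y hy => (hP y (by simp [s, hy])).symm
  have h2 : ∀ Q : Polynomial ℝ, Polynomial.aeval a Q x = ((Q.eval r : ℝ) : ℂ) • x := by
    intro Q
    induction Q using Polynomial.induction_on' with
    | add p q hp hq => simp [hp, hq, add_smul]
    | monomial n c =>
      have : ∀ n : ℕ, (a ^ n) x = ((r : ℂ) ^ n) • x := by
        intro n
        induction n with
        | zero => simp
        | succ n ih => rw [pow_succ, mul_apply_eq_comp, hx, map_smul, ih, smul_smul,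
            pow_succ']
      simp [Polynomial.aeval_monomial, this, Algebra.algebraMap_eq_smul_one, mul_smul]
  rw [h1, h2, hP r (by simp [s])]

end Spectral

/-! ### The Schwarz inequality for the trace dual -/

section Schwarz

variable {H H' : Type*}
  [NormedAddCommGroup H] [InnerProductSpace ℂ H] [CompleteSpace H]
  [NormedAddCommGroup H'] [InnerProductSpace ℂ H'] [CompleteSpace H']

/-- With `ρ = S* S`, this matrix is the Gram matrix of the row `(S, S Z*)`. -/
lemma two_by_two_nonneg {ρ : H →L[ℂ] H} (hρ : 0 ≤ ρ) (Z : H →L[ℂ] H) :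
    0 ≤ CStarMatrix.ofMatrix !![ρ, ρ * star Z; Z * ρ, Z * ρ * star Z] := by
  obtain ⟨S, rfl⟩ := CStarAlgebra.nonneg_iff_eq_star_mul_self.1 hρ
  convert star_mul_self_nonneg
    (CStarMatrix.ofMatrix !![S, S * star Z; 0, 0] : CStarMatrix (Fin 2) (Fin 2) (H →L[ℂ] H))
  ext i j : 2
  fin_cases i <;> fin_cases j <;>
    simp [CStarMatrix.mul_apply, Fin.sum_univ_two, CStarMatrix.star_apply, mul_assoc]

/-- The trace dual of `E` at `Y`: an operator `Z` with `tr (Z X) = tr (Y E(X))` for all `X`. -/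
lemma exists_opTrace_dual [FiniteDimensional ℂ H] (E : (H →L[ℂ] H) →CP (H' →L[ℂ] H'))
    (Y : H' →L[ℂ] H') : ∃ Z : H →L[ℂ] H, ∀ X, opTrace (Z * X) = opTrace (Y * E X) :=
  exists_opTrace_mul_eq (opTraceForm Y ∘ₗ E.toLinearMap)

/-- A positive `2 × 2` operator matrix has nonnegative trace after multiplication by the row
`(Y, -1)` on the left and by its adjoint on the right. -/
lemma re_opTrace_two_by_two_nonneg [FiniteDimensional ℂ H]
    {M : CStarMatrix (Fin 2) (Fin 2) (H →L[ℂ] H)} (hM : 0 ≤ M) (Y : H →L[ℂ] H) :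
    0 ≤ (opTrace (Y * M 0 0 * star Y - Y * M 0 1 - M 1 0 * star Y + M 1 1)).re := by
  rw [StarOrderedRing.nonneg_iff] at hM
  induction hM using AddSubmonoid.closure_induction with
  | mem _ hx =>
    obtain ⟨N, rfl⟩ := hx
    let A : Fin 2 → (H →L[ℂ] H) := fun c => N c 0 * star Y - N c 1
    -- `A` is the product of `N` with the column `(Y*, -1)`, and the operator is `A* A`.
    have h : 0 ≤ star (A 0) * A 0 + star (A 1) * A 1 :=
      add_nonneg (star_mul_self_nonneg _) (star_mul_self_nonneg _)
    convert re_opTrace_nonneg h using 3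
    simp only [CStarMatrix.mul_apply, Fin.sum_univ_two, CStarMatrix.star_apply, A, star_sub,
      star_mul, star_star]
    noncomm_ring
  | zero => simp [opTrace]
  | add M N _ _ hM hN =>
    have h := add_nonneg hM hN
    rw [← Complex.add_re, ← opTrace_add] at h
    refine h.trans_eq (congrArg (fun X => (opTrace X).re) ?_)
    simp only [CStarMatrix.add_apply]
    noncomm_ring

variable [FiniteDimensional ℂ H']

/-- The Kadison–Schwarz inequality for the trace dual of a completely positive trace-preserving
map. -/
lemma re_opTrace_schwarz {E : (H →L[ℂ] H) →CP (H' →L[ℂ] H')} (hE : TracePreserving E)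
    {Y : H' →L[ℂ] H'} {Z : H →L[ℂ] H} (hZ : ∀ X, opTrace (Z * X) = opTrace (Y * E X))
    {ρ : H →L[ℂ] H} (hρ : 0 ≤ ρ) :
    (opTrace (ρ * (star Z * Z))).re ≤ (opTrace (E ρ * (star Y * Y))).re := by
  have h := re_opTrace_two_by_two_nonneg
    (CompletelyPositiveMap.map_cstarMatrix_nonneg E _ (two_by_two_nonneg hρ Z)) Y
  simp only [CStarMatrix.map_apply, CStarMatrix.ofMatrix_apply, Matrix.of_apply,
    Matrix.cons_val', Matrix.cons_val_zero, Matrix.cons_val_one, Matrix.cons_val_fin_one,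
    opTrace_add, opTrace_sub, Complex.add_re, Complex.sub_re] at h
  have e1 : opTrace (Y * E ρ * star Y) = opTrace (E ρ * (star Y * Y)) := by
    rw [mul_assoc, opTrace_mul_comm, mul_assoc]
  have e2 : opTrace (Y * E (ρ * star Z)) = opTrace (ρ * (star Z * Z)) := by
    rw [← hZ, opTrace_mul_comm, mul_assoc]
  have e3 : (opTrace (E (Z * ρ) * star Y)).re = (opTrace (ρ * (star Z * Z))).re := by
    have hs : star (E (Z * ρ)) = E (ρ * star Z) := by
      rw [← map_star E, star_mul, hρ.isSelfAdjoint.star_eq]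
    rw [← e2, ← hs, ← Complex.conj_re, ← Complex.star_def, ← opTrace_star, star_mul, star_star]
  have e4 : opTrace (E (Z * ρ * star Z)) = opTrace (ρ * (star Z * Z)) := by
    rw [hE, mul_assoc, opTrace_mul_comm, mul_assoc]
  rw [e1, e2, e3, e4] at h
  linarith

/-- The trace dual of a positive map commutes with the adjoint. -/
lemma opTrace_star_mul_eq [FiniteDimensional ℂ H] {E : (H →L[ℂ] H) →CP (H' →L[ℂ] H')}
    {Y : H' →L[ℂ] H'} {Z : H →L[ℂ] H} (hZ : ∀ X, opTrace (Z * X) = opTrace (Y * E X))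
    (X : H →L[ℂ] H) : opTrace (star Z * X) = opTrace (star Y * E X) := by
  have h := hZ (star X)
  rw [map_star E, opTrace_mul_comm, opTrace_mul_comm Y] at h
  have h2 := congrArg star h
  rwa [← opTrace_star, ← opTrace_star, star_mul, star_mul, star_star, star_star] at h2

end Schwarz

/-! ### Scalar functions -/

section Scalar

/-- The primitive, vanishing at `t = 0`, of `p / (1 + t) - p q / (p + t q)`. For `q > 0` it tends to
`p (log p - log q)` as `t → ∞`. -/
noncomputable def entropyPrimitive (p q t : ℝ) : ℝ :=
  p * (Real.log (1 + t) - Real.log (p + t * q) + Real.log p)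

lemma entropyPrimitive_zero_right (p q : ℝ) : entropyPrimitive p q 0 = 0 := by
  simp [entropyPrimitive]

lemma hasDerivAt_entropyPrimitive {p q t : ℝ} (hp : 0 ≤ p) (hq : 0 ≤ q) (ht : 0 ≤ t) :
    HasDerivAt (entropyPrimitive p q) (p * (1 / (1 + t) - q / (p + t * q))) t := by
  rcases hp.eq_or_lt with rfl | hp
  · have : entropyPrimitive 0 q = fun _ => 0 := by ext; simp [entropyPrimitive]
    simpa [this] using hasDerivAt_const t (0 : ℝ)
  · have h1 : HasDerivAt (fun s : ℝ => 1 + s) 1 t := (hasDerivAt_id t).const_add 1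
    have h2 : HasDerivAt (fun s : ℝ => p + s * q) q t := by
      simpa using ((hasDerivAt_id t).mul_const q).const_add p
    exact (((h1.log (by positivity)).sub (h2.log (by positivity))).add_const _).const_mul p

/-- The left side is the form that is continuous up to `t = 0`; the right side is the one whose
sum over eigenvalue pairs involves only `tr ρ`, `tr σ` and the maximum of `modularForm`. -/
lemma entropyPrimitive_deriv_eq {p q t : ℝ} (hp : 0 ≤ p) (hq : 0 ≤ q) (ht : 0 < t) :
    p * (1 / (1 + t) - q / (p + t * q)) = p / (1 + t) - q + t * (q ^ 2 / (p + t * q)) := by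
  rcases (by positivity : 0 ≤ p + t * q).eq_or_lt with h | h
  · have hq0 : q = 0 := by nlinarith
    simp [hq0, div_eq_mul_inv]
  · field_simp
    ring

lemma tendsto_entropyPrimitive {p q : ℝ} (hp : 0 ≤ p) (hq : 0 < q) :
    Tendsto (entropyPrimitive p q) atTop (𝓝 (p * (Real.log p - Real.log q))) := by
  have h0 : Tendsto (fun t : ℝ => (1 + t)⁻¹) atTop (𝓝 0) :=
    tendsto_inv_atTop_zero.comp (tendsto_atTop_add_const_left _ _ tendsto_id)
  have h1 : Tendsto (fun t : ℝ => q + (p - q) * (1 + t)⁻¹) atTop (𝓝 q) := by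
    simpa using (h0.const_mul (p - q)).const_add q
  have h2 : Tendsto (fun t : ℝ => p * (Real.log p - Real.log (q + (p - q) * (1 + t)⁻¹))) atTop
      (𝓝 (p * (Real.log p - Real.log q))) := ((h1.log hq.ne').const_sub _).const_mul p
  refine h2.congr' ?_
  filter_upwards [eventually_gt_atTop 0] with t ht
  have h3 : q + (p - q) * (1 + t)⁻¹ = (p + t * q) / (1 + t) := by field_simp; ring
  rw [entropyPrimitive, h3, Real.log_div (by positivity) (by positivity)]
  ring

/-- Completing the square in `y`. When `p + t q = 0` also `q = 0`, and the quotient by zero on the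
right has the correct value `0`. -/
lemma two_mul_re_sub_le {p q t : ℝ} (hp : 0 ≤ p) (hq : 0 ≤ q) (ht : 0 < t) (c y : ℂ) :
    2 * q * (c * y).re - (p + t * q) * ‖y‖ ^ 2 ≤ ‖c‖ ^ 2 * (q ^ 2 / (p + t * q)) := by
  have hs : 0 ≤ p + t * q := by positivity
  have h1 : (c * y).re ≤ ‖c‖ * ‖y‖ := (Complex.re_le_norm _).trans_eq (norm_mul _ _)
  rcases hs.eq_or_lt with h | h
  · have hq0 : q = 0 := by nlinarith
    rw [← h, hq0]
    simp
  · generalize p + t * q = s at h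
    have h2 : ‖c‖ ^ 2 * (q ^ 2 / s) - (2 * q * (‖c‖ * ‖y‖) - s * ‖y‖ ^ 2)
        = (q * ‖c‖ - s * ‖y‖) ^ 2 / s := by
      field_simp
      ring
    have h3 : 0 ≤ (q * ‖c‖ - s * ‖y‖) ^ 2 / s := by positivity
    nlinarith [mul_le_mul_of_nonneg_left h1 hq]

/-- The maximizer of the quadratic expression of `two_mul_re_sub_le`. -/
lemma two_mul_re_sub_eq {p q t : ℝ} (c : ℂ) :
    2 * q * (star c * ((q / (p + t * q) : ℝ) * c)).re
      - (p + t * q) * ‖((q / (p + t * q) : ℝ) * c : ℂ)‖ ^ 2 = ‖c‖ ^ 2 * (q ^ 2 / (p + t * q)) := by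
  have h1 : (star c * ((q / (p + t * q) : ℝ) * c)).re = q / (p + t * q) * ‖c‖ ^ 2 := by
    rw [mul_left_comm, Complex.star_def, Complex.conj_mul', Complex.re_ofReal_mul]
    norm_cast
  rw [h1, norm_mul, mul_pow, Complex.norm_real, Real.norm_eq_abs, sq_abs]
  rcases eq_or_ne (p + t * q) 0 with h | h
  · simp [h]
  · field_simp
    ring

end Scalar

/-! ### The variational functional -/

section Variational

variable {H : Type*} [NormedAddCommGroup H] [InnerProductSpace ℂ H]
  {ι κ : Type*} [Fintype ι] [Fintype κ] {ρ σ : H →L[ℂ] H}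
  {b : OrthonormalBasis ι ℂ H} {f : OrthonormalBasis κ ℂ H} {p : ι → ℝ} {q : κ → ℝ}

/-- The `i`-th weights `‖⟪b i, f j⟫‖ ^ 2` sum to one over `j`, whatever the basis `f`. -/
lemma re_opTrace_eq_sum_left (hb : ∀ i, ρ (b i) = (p i : ℂ) • b i)
    (f : OrthonormalBasis κ ℂ H) (g : ι → ℝ) {T : H →L[ℂ] H}
    (hT : ∀ i, T (b i) = (g i : ℂ) • b i) :
    (opTrace (ρ * T)).re = ∑ j, ∑ i, ‖⟪b i, f j⟫_ℂ‖ ^ 2 * (p i * g i) := by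
  rw [opTrace_mul_comm, opTrace_mul_eq_sum hb, Complex.re_sum, Finset.sum_comm]
  refine Finset.sum_congr rfl fun i _ => ?_
  rw [← Finset.sum_mul, f.sum_sq_norm_inner_left, hT]
  simp [← Complex.ofReal_mul]

variable [CompleteSpace H]

lemma re_opTrace_eq_sum_right (hρ : IsSelfAdjoint ρ) (hb : ∀ i, ρ (b i) = (p i : ℂ) • b i)
    (g : κ → ℝ) {T : H →L[ℂ] H} (hT : ∀ j, T (f j) = (g j : ℂ) • f j) :
    (opTrace (ρ * T)).re = ∑ j, ∑ i, ‖⟪b i, f j⟫_ℂ‖ ^ 2 * (p i * g j) := by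
  rw [opTrace_mul_eq_sum hT, Complex.re_sum]
  refine Finset.sum_congr rfl fun j _ => ?_
  rw [Complex.re_ofReal_mul, inner_apply_eq_sum hρ hb, Complex.ofReal_re, Finset.mul_sum]
  exact Finset.sum_congr rfl fun i _ => by ring

lemma re_opTrace_mul_star_mul_self (hb : ∀ i, ρ (b i) = (p i : ℂ) • b i) (X : H →L[ℂ] H) :
    (opTrace (ρ * (star X * X))).re = ∑ i, p i * ‖X (b i)‖ ^ 2 := by
  rw [opTrace_mul_comm, opTrace_mul_eq_sum hb, Complex.re_sum]
  refine Finset.sum_congr rfl fun i _ => ?_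
  rw [Complex.re_ofReal_mul, mul_apply_eq_comp, ContinuousLinearMap.star_eq_adjoint,
    ContinuousLinearMap.adjoint_inner_right]
  congr 1
  exact inner_self_eq_norm_sq (𝕜 := ℂ) _

/-- The concave quadratic functional of `Y` whose maximum, for invertible `σ`, is
`⟨σ^{1/2}, (Δ + t)⁻¹ σ^{1/2}⟩` in the Hilbert–Schmidt inner product, where `Δ = L_ρ R_σ⁻¹` is the
relative modular operator. The expression in `Y` involves neither roots nor inverses, so that it
makes sense for all pairs of positive operators. -/
noncomputable def modularForm (ρ σ : H →L[ℂ] H) (t : ℝ) (Y : H →L[ℂ] H) : ℝ :=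
  2 * (opTrace (Y * σ)).re - (opTrace (ρ * (Y * star Y))).re
    - t * (opTrace (σ * (star Y * Y))).re

lemma modularForm_eq_sum (hb : ∀ i, ρ (b i) = (p i : ℂ) • b i)
    (hf : ∀ j, σ (f j) = (q j : ℂ) • f j) (t : ℝ) (Y : H →L[ℂ] H) :
    modularForm ρ σ t Y = ∑ j, ∑ i, (2 * q j * (star ⟪b i, f j⟫_ℂ * ⟪b i, Y (f j)⟫_ℂ).re
      - (p i + t * q j) * ‖⟪b i, Y (f j)⟫_ℂ‖ ^ 2) := by
  have h1 : (opTrace (Y * σ)).re =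
      ∑ j, ∑ i, q j * (star ⟪b i, f j⟫_ℂ * ⟪b i, Y (f j)⟫_ℂ).re := by
    rw [opTrace_mul_eq_sum hf, Complex.re_sum]
    refine Finset.sum_congr rfl fun j _ => ?_
    rw [Complex.re_ofReal_mul, ← b.sum_inner_mul_inner, Complex.re_sum, Finset.mul_sum]
    simp only [Complex.star_def, inner_conj_symm]
  have h2 : (opTrace (ρ * (Y * star Y))).re = ∑ j, ∑ i, p i * ‖⟪b i, Y (f j)⟫_ℂ‖ ^ 2 := by
    have := re_opTrace_mul_star_mul_self hb (star Y)
    rw [star_star] at this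
    rw [this, Finset.sum_comm]
    refine Finset.sum_congr rfl fun i _ => ?_
    rw [← f.sum_sq_norm_inner_right, Finset.mul_sum]
    refine Finset.sum_congr rfl fun j _ => ?_
    rw [ContinuousLinearMap.star_eq_adjoint, ContinuousLinearMap.adjoint_inner_right,
      norm_inner_symm]
  have h3 : (opTrace (σ * (star Y * Y))).re = ∑ j, ∑ i, q j * ‖⟪b i, Y (f j)⟫_ℂ‖ ^ 2 := by
    rw [re_opTrace_mul_star_mul_self hf]
    refine Finset.sum_congr rfl fun j _ => ?_
    rw [← b.sum_sq_norm_inner_right, Finset.mul_sum]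
  rw [modularForm, h1, h2, h3]
  simp only [Finset.mul_sum, ← Finset.sum_sub_distrib]
  refine Finset.sum_congr rfl fun j _ => Finset.sum_congr rfl fun i _ => ?_
  ring

variable [FiniteDimensional ℂ H]

lemma isGreatest_modularForm (hp : ∀ i, 0 ≤ p i) (hq : ∀ j, 0 ≤ q j)
    (hb : ∀ i, ρ (b i) = (p i : ℂ) • b i) (hf : ∀ j, σ (f j) = (q j : ℂ) • f j)
    {t : ℝ} (ht : 0 < t) :
    IsGreatest (Set.range (modularForm ρ σ t))
      (∑ j, ∑ i, ‖⟪b i, f j⟫_ℂ‖ ^ 2 * (q j ^ 2 / (p i + t * q j))) := by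
  constructor
  · let Y : H →L[ℂ] H := LinearMap.toContinuousLinearMap (f.toBasis.constr ℂ fun j =>
      ∑ i, (((q j / (p i + t * q j) : ℝ) : ℂ) * ⟪b i, f j⟫_ℂ) • b i)
    have hY : ∀ i j, ⟪b i, Y (f j)⟫_ℂ = ((q j / (p i + t * q j) : ℝ) : ℂ) * ⟪b i, f j⟫_ℂ := by
      intro i j
      have : Y (f j) = ∑ i, (((q j / (p i + t * q j) : ℝ) : ℂ) * ⟪b i, f j⟫_ℂ) • b i := by
        have h := f.toBasis.constr_basis ℂ (fun j =>
          ∑ i, (((q j / (p i + t * q j) : ℝ) : ℂ) * ⟪b i, f j⟫_ℂ) • b i) j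
        rwa [f.coe_toBasis] at h
      rw [this, b.orthonormal.inner_right_fintype]
    refine ⟨Y, ?_⟩
    rw [modularForm_eq_sum hb hf]
    refine Finset.sum_congr rfl fun j _ => Finset.sum_congr rfl fun i _ => ?_
    rw [hY, two_mul_re_sub_eq]
  · rintro _ ⟨Y, rfl⟩
    rw [modularForm_eq_sum hb hf]
    refine Finset.sum_le_sum fun j _ => Finset.sum_le_sum fun i _ => ?_
    rw [← norm_star ⟪b i, f j⟫_ℂ]
    exact two_mul_re_sub_le (hp i) (hq j) ht _ _

end Variational

/-! ### Relative entropy as a limit -/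

section Interpolation

variable {H : Type*} [NormedAddCommGroup H] [InnerProductSpace ℂ H] [FiniteDimensional ℂ H]
  [CompleteSpace H]

/-- The relative entropy as the limit of a primitive `K`. The derivative of `K` depends on the pair
`(ρ, σ)` only through the two traces and the maximum `v` of `modularForm ρ σ t`. -/
lemma exists_interpolation {ρ σ : H →L[ℂ] H} (hρ : 0 ≤ ρ) (hσ : 0 ≤ σ)
    (hker : ∀ ψ : H, σ ψ = 0 → ⟪ψ, ρ ψ⟫_ℂ = 0) :
    ∃ K : ℝ → ℝ, K 0 = 0 ∧ (∀ t, 0 ≤ t → ContinuousAt K t) ∧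
      (∀ t, 0 < t → ∃ v, IsGreatest (Set.range (modularForm ρ σ t)) v ∧
        HasDerivAt K ((opTrace ρ).re / (1 + t) - (opTrace σ).re + t * v) t) ∧
      Tendsto K atTop (𝓝 (opTrace (ρ * CFC.log ρ) - opTrace (ρ * CFC.log σ)).re) := by
  obtain ⟨b, p, hp, hb⟩ := exists_eigenbasis_of_nonneg hρ
  obtain ⟨f, q, hq, hf⟩ := exists_eigenbasis_of_nonneg hσ
  have hder : ∀ t, 0 ≤ t → HasDerivAt
      (fun t => ∑ j, ∑ i, ‖⟪b i, f j⟫_ℂ‖ ^ 2 * entropyPrimitive (p i) (q j) t)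
      (∑ j, ∑ i, ‖⟪b i, f j⟫_ℂ‖ ^ 2 * (p i * (1 / (1 + t) - q j / (p i + t * q j)))) t :=
    fun t ht => HasDerivAt.fun_sum fun j _ => HasDerivAt.fun_sum fun i _ =>
      (hasDerivAt_entropyPrimitive (hp i) (hq j) ht).const_mul _
  refine ⟨fun t => ∑ j, ∑ i, ‖⟪b i, f j⟫_ℂ‖ ^ 2 * entropyPrimitive (p i) (q j) t,
    by simp [entropyPrimitive_zero_right], fun t ht => (hder t ht).continuousAt,
    fun t ht => ⟨_, isGreatest_modularForm hp hq hb hf ht, ?_⟩, ?_⟩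
  · have hρtr : (opTrace ρ).re = ∑ j, ∑ i, ‖⟪b i, f j⟫_ℂ‖ ^ 2 * p i := by
      simpa using re_opTrace_eq_sum_left hb f (fun _ => 1) (T := 1) (by simp)
    have hσtr : (opTrace σ).re = ∑ j, ∑ i, ‖⟪b i, f j⟫_ℂ‖ ^ 2 * q j := by
      have := re_opTrace_eq_sum_left hf b (fun _ => 1) (T := 1) (by simp)
      rw [Finset.sum_comm] at this
      simpa [norm_inner_symm] using this
    convert hder t ht.le using 1
    rw [hρtr, hσtr]
    simp only [entropyPrimitive_deriv_eq (hp _) (hq _) ht, Finset.sum_div, Finset.mul_sum,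
      ← Finset.sum_sub_distrib, ← Finset.sum_add_distrib]
    refine Finset.sum_congr rfl fun j _ => Finset.sum_congr rfl fun i _ => ?_
    ring
  · rw [Complex.sub_re, CFC.log, CFC.log, re_opTrace_eq_sum_left hb f (fun i => Real.log (p i))
        fun i => cfc_apply_of_apply_eq_smul _ hρ.isSelfAdjoint (hb i),
      re_opTrace_eq_sum_right hρ.isSelfAdjoint hb (fun j => Real.log (q j))
        fun j => cfc_apply_of_apply_eq_smul _ hσ.isSelfAdjoint (hf j)]
    simp only [← Finset.sum_sub_distrib]
    refine tendsto_finsetSum _ fun j _ => tendsto_finsetSum _ fun i _ => ?_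
    rcases (hq j).eq_or_lt with h | h
    -- If `q j = 0`, the support condition makes the weighted term vanish for all `t`.
    · have h0 := hker (f j) (by rw [hf, ← h]; simp)
      rw [inner_apply_eq_sum hρ.isSelfAdjoint hb, Complex.ofReal_eq_zero,
        Finset.sum_eq_zero_iff_of_nonneg fun i _ => mul_nonneg (hp i) (by positivity)] at h0
      have h1 := h0 i (Finset.mem_univ i)
      have h2 : ∀ x : ℝ, ‖⟪b i, f j⟫_ℂ‖ ^ 2 * (p i * x) = 0 := fun x => by
        rw [← mul_assoc, mul_comm _ (p i), h1, zero_mul]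
      simp only [entropyPrimitive, h2, sub_zero]
      exact tendsto_const_nhds
    · simpa only [mul_sub] using (tendsto_entropyPrimitive (hp i) h).const_mul _

end Interpolation

/-! ### Behaviour under completely positive trace-preserving maps -/

section Monotonicity

variable {H H' : Type*}
  [NormedAddCommGroup H] [InnerProductSpace ℂ H] [FiniteDimensional ℂ H] [CompleteSpace H]
  [NormedAddCommGroup H'] [InnerProductSpace ℂ H'] [FiniteDimensional ℂ H'] [CompleteSpace H']
  {E : (H →L[ℂ] H) →CP (H' →L[ℂ] H')} {ρ σ : H →L[ℂ] H}

lemma exists_modularForm_le (hE : TracePreserving E) (hρ : 0 ≤ ρ) (hσ : 0 ≤ σ) {t : ℝ}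
    (ht : 0 ≤ t) (Y : H' →L[ℂ] H') :
    ∃ Z, modularForm (E ρ) (E σ) t Y ≤ modularForm ρ σ t Z := by
  obtain ⟨Z, hZ⟩ := exists_opTrace_dual E Y
  refine ⟨Z, ?_⟩
  have h1 := re_opTrace_schwarz hE hZ hσ
  have h2 := re_opTrace_schwarz hE (opTrace_star_mul_eq hZ) hρ
  rw [star_star, star_star] at h2
  have h3 := mul_le_mul_of_nonneg_left h1 ht
  rw [modularForm, modularForm, hZ]
  linarith

/-- The image pair inherits the support condition under which the relative entropy is finite. -/
lemma inner_map_eq_zero (hE : TracePreserving E) (hρ : 0 ≤ ρ) (hσ : 0 ≤ σ)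
    (hker : ∀ ψ : H, σ ψ = 0 → ⟪ψ, ρ ψ⟫_ℂ = 0) {ψ : H'} (hψ : E σ ψ = 0) :
    ⟪ψ, E ρ ψ⟫_ℂ = 0 := by
  obtain ⟨f, q, hq, hf⟩ := exists_eigenbasis_of_nonneg hσ
  let Y : H' →L[ℂ] H' := InnerProductSpace.rankOne ℂ ψ ψ
  obtain ⟨Z, hZ⟩ := exists_opTrace_dual E Y
  have hY : star Y = Y := by
    rw [ContinuousLinearMap.star_eq_adjoint]; exact InnerProductSpace.adjoint_rankOne ψ ψ
  have hEY : E σ * Y = 0 := by ext x; simp [Y, hψ]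
  have h1 := re_opTrace_schwarz hE hZ hσ
  rw [hY, ← mul_assoc (E σ), hEY, zero_mul, re_opTrace_mul_star_mul_self hf] at h1
  have h2 := le_antisymm (h1.trans_eq (by simp [opTrace]))
    (Finset.sum_nonneg fun j _ => mul_nonneg (hq j) (by positivity))
  rw [Finset.sum_eq_zero_iff_of_nonneg fun j _ => mul_nonneg (hq j) (by positivity)] at h2
  -- `Z` kills the eigenvectors of `σ` with nonzero eigenvalue, and `ρ` kills the others.
  have h3 : opTrace (Z * ρ) = 0 := by
    rw [opTrace_mul_comm, opTrace_eq_sum_inner f]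
    refine Finset.sum_eq_zero fun j hj => ?_
    rw [mul_apply_eq_comp]
    rcases mul_eq_zero.1 (h2 j hj) with h | h
    · have h0 : ρ (f j) = 0 :=
        apply_eq_zero_of_inner_eq_zero hρ (hker _ (by rw [hf, h]; simp))
      rw [← ContinuousLinearMap.adjoint_inner_left, ← ContinuousLinearMap.star_eq_adjoint,
        hρ.isSelfAdjoint.star_eq, h0, inner_zero_left]
    · rw [norm_eq_zero.1 (pow_eq_zero_iff two_ne_zero |>.1 h), map_zero, inner_zero_right]
  rw [hZ, opTrace_mul_comm, opTrace_eq_sum_inner (stdOrthonormalBasis ℂ H')] at h3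
  rw [← (stdOrthonormalBasis ℂ H').sum_inner_mul_inner, ← h3]
  refine Finset.sum_congr rfl fun i _ => ?_
  simp [Y]

end Monotonicity

end QuantumEntropy

theorem theorem3p5 {H H' : Type*}
    [NormedAddCommGroup H] [InnerProductSpace ℂ H] [FiniteDimensional ℂ H] [CompleteSpace H]
    [NormedAddCommGroup H'] [InnerProductSpace ℂ H'] [FiniteDimensional ℂ H'] [CompleteSpace H']
    (ρ σ : H →L[ℂ] H)
    (hρ : ρ ∈ QuantumEntropy.densityOperators H) (hσ : σ ∈ QuantumEntropy.densityOperators H)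
    (E : (H →L[ℂ] H) →CP (H' →L[ℂ] H')) (hE : QuantumEntropy.TracePreserving E) :
    QuantumEntropy.relativeEntropy (E ρ) (E σ) ≤ QuantumEntropy.relativeEntropy ρ σ := by
  open QuantumEntropy Filter Topology in
  by_cases hsupp : ∃ ψ : H, σ ψ = 0 ∧ ⟪ψ, ρ ψ⟫_ℂ ≠ 0
  · rw [relativeEntropy, relativeEntropy, if_pos hsupp]
    exact le_top
  have hker : ∀ ψ : H, σ ψ = 0 → ⟪ψ, ρ ψ⟫_ℂ = 0 := by simpa using hsupp
  have hker' : ∀ ψ : H', E σ ψ = 0 → ⟪ψ, E ρ ψ⟫_ℂ = 0 := fun ψ =>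
    inner_map_eq_zero hE hρ.1 hσ.1 hker
  have hsupp' : ¬ ∃ ψ : H', E σ ψ = 0 ∧ ⟪ψ, E ρ ψ⟫_ℂ ≠ 0 := by simpa using hker'
  rw [relativeEntropy, relativeEntropy, if_neg hsupp, if_neg hsupp', EReal.coe_le_coe_iff]
  obtain ⟨K, hK0, hKc, hKd, hKlim⟩ := exists_interpolation hρ.1 hσ.1 hker
  obtain ⟨L, hL0, hLc, hLd, hLlim⟩ :=
    exists_interpolation (map_nonneg E hρ.1) (map_nonneg E hσ.1) hker'
  -- The trace terms of the two derivatives agree, and the maximum for the images is the smaller.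
  have hmono : MonotoneOn (K - L) (Set.Ici 0) := by
    refine monotoneOn_of_deriv_nonneg (convex_Ici 0)
      (fun t ht => ((hKc t ht).sub (hLc t ht)).continuousWithinAt) ?_ ?_
    · intro t ht
      rw [interior_Ici] at ht
      obtain ⟨v, -, hv⟩ := hKd t ht
      obtain ⟨w, -, hw⟩ := hLd t ht
      exact (hv.sub hw).differentiableAt.differentiableWithinAt
    · intro t ht
      rw [interior_Ici] at ht
      obtain ⟨v, hvmax, hv⟩ := hKd t ht
      obtain ⟨w, hwmax, hw⟩ := hLd t ht
      obtain ⟨Y, rfl⟩ := hwmax.1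
      obtain ⟨Z, hZ⟩ := exists_modularForm_le hE hρ.1 hσ.1 (le_of_lt ht) Y
      have hwv := mul_le_mul_of_nonneg_left (hZ.trans (hvmax.2 ⟨Z, rfl⟩)) (le_of_lt ht)
      rw [(hv.sub hw).deriv, hE ρ, hE σ]
      linarith
  refine le_of_tendsto_of_tendsto hLlim hKlim ?_
  filter_upwards [eventually_ge_atTop 0] with t ht
  have h := hmono Set.self_mem_Ici ht ht
  simpa [hK0, hL0] using h
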